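/- Let $A\in\mathbb R^{n\times n}$, $B=[b_1\,\cdots\,b_m]\in\mathbb R^{n\times m}$ with $n\ge 1$, and suppose that the system $x(k+1)=Ax(k)+Bu(k)$ is controllable, i.e. $[B\ AB\ \cdots\ A^{n-1}B]$ has rank $n$. For a horizon $t\ge n$ let $\mathcal C(t)=[B\ AB\ \cdots\ A^{t-1}B]$ and let $\mathcal W(t)=\sum_{i=0}^{t-1}A^iBB^\top(A^i)^\top=\mathcal C(t)\mathcal C(t)^\top$ be the controllability Gramian. A weighted actuator schedule is a family of scalings $s_i(k)\ge 0$ ($1\le i\le m$, $0\le k\le t-1$), with active sets $\sigma_k=\{i: s_i(k)>0\}$ and Gramian $$\mathcal W_s(t)=\sum_{k=0}^{t-1}\sum_{j\in\sigma_k}s_j(k)^2\,(A^{t-k-1}b_j)(A^{t-k-1}b_j)^\top .$$ It is an $(\epsilon,\delta)$-approximation of the fully actuated system if $(1-\epsilon)\mathcal W(t)\preceq\mathcal W_s(t)\preceq(1+\epsilon)\mathcal W(t)$ and the average number of active actuators satisfies $\frac1t\sum_{k=0}^{t-1}|\sigma_k|\le \delta$. Consider the following randomized algorithm with input $A,B,t$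 and a real number $d>0$. Put $M=\lceil dt\rceil$ and draw $M$ independent pairs $(i,k)\in\{1,\dots,m\}\times\{0,\dots,t-1\}$, each with the distribution proportional to the leverage scores, $$\pi(i,k)=\tfrac1n\,\mathrm{tr}\Big(\big(\mathcal C(t)\mathcal C(t)^\top\big)^{\dagger}A^{t-k-1}b_i\,(A^{t-k-1}b_i)^\top\Big).$$ Starting from zero scalings, each time a pair $(i,k)$ is drawn, increase $s_i(k)^2$ by $\frac{1}{M\pi(i,k)}$. Then there is an absolute constant $C>0$ such that for all $n,m,A,B,t$ as above, all $\epsilon\in[1/\sqrt n,1)$ and all real $d\ge C\,\frac{n\log n}{\epsilon^2 t}$, with probability at least $1/2$ the schedule produced by the algorithm is an $(\epsilon,\lceil dt\rceil/t)$-approximation: $(1-\epsilon)\mathcal W(t)\preceq\mathcal W_s(t)\preceq(1+\epsilon)\mathcal W(t)$, with at most $\lceil dt\rceil$ active (actuator, time) pairs in total, i.e. at most $\lceil dt\rceil/t$ active actuators on average (which is $d$ when $dt$ is an integer). -/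

import Mathlib

open scoped ENNReal Matrix

namespace ActuatorScheduling

/-- `P` is a Moore–Penrose pseudo-inverse of the real matrix `W` (the four Penrose equations). -/
def IsMoorePenrose {m n : ℕ} (W : Matrix (Fin m) (Fin n) ℝ) (P : Matrix (Fin n) (Fin m) ℝ) :
    Prop :=
  W * P * W = W ∧ P * W * P = P ∧ (W * P)ᵀ = W * P ∧ (P * W)ᵀ = P * W

open Classical in
/-- The Moore–Penrose pseudo-inverse `W†`, i.e. the (unique) solution of the Penrose equations. -/
noncomputable def pinv {m n : ℕ} (W : Matrix (Fin m) (Fin n) ℝ) : Matrix (Fin n) (Fin m) ℝ :=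
  if h : ∃ P, IsMoorePenrose W P then h.choose else 0

/-- For an invertible matrix the pseudo-inverse is the inverse. -/
theorem pinv_eq_inv {n : ℕ} {W : Matrix (Fin n) (Fin n) ℝ} (hW : IsUnit W.det) :
    pinv W = W⁻¹ := by
  have hex : ∃ P, IsMoorePenrose W P := by
    refine ⟨W⁻¹, ?_, ?_, ?_, ?_⟩ <;>
      simp [Matrix.mul_nonsing_inv _ hW, Matrix.nonsing_inv_mul _ hW]
  have h := hex.choose_spec.1
  have hdef : pinv W = hex.choose := by
    unfold pinv
    rw [dif_pos hex]
  rw [hdef]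
  calc hex.choose = W⁻¹ * (W * hex.choose * W) * W⁻¹ := by
        rw [Matrix.mul_assoc W, ← Matrix.mul_assoc W⁻¹, Matrix.nonsing_inv_mul _ hW,
          Matrix.one_mul, Matrix.mul_assoc, Matrix.mul_nonsing_inv _ hW, Matrix.mul_one]
    _ = W⁻¹ := by rw [h, Matrix.nonsing_inv_mul _ hW, Matrix.one_mul]

/-- The controllability matrix `C(t) = [B  AB  A²B  ⋯  A^{t-1}B]`; its column with index `(i, j)`
is `A^i b_j`. -/
def ctrbMatrix {n m : ℕ} (A : Matrix (Fin n) (Fin n) ℝ) (B : Matrix (Fin n) (Fin m) ℝ) (t : ℕ) :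
    Matrix (Fin n) (Fin t × Fin m) ℝ :=
  Matrix.of fun r p => (A ^ (p.1 : ℕ) * B) r p.2

/-- Controllability of `x(k+1) = A x(k) + B u(k)`: the Kalman matrix `[B AB ⋯ A^{n-1}B]` has full
row rank. -/
def IsControllable {n m : ℕ} (A : Matrix (Fin n) (Fin n) ℝ) (B : Matrix (Fin n) (Fin m) ℝ) :
    Prop :=
  (ctrbMatrix A B n).rank = n

/-- The controllability Gramian `W(t) = ∑_{i < t} A^i B Bᵀ (A^i)ᵀ`. -/
def gramian {n m : ℕ} (A : Matrix (Fin n) (Fin n) ℝ) (B : Matrix (Fin n) (Fin m) ℝ) (t : ℕ) :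
    Matrix (Fin n) (Fin n) ℝ :=
  ∑ i : Fin t, A ^ (i : ℕ) * B * Bᵀ * (A ^ (i : ℕ))ᵀ

/-- The vector `A^{t-k-1} b_i`, the effect on the state at time `t` of a unit input on actuator `i`
at time `k ∈ {0, …, t-1}`. -/
def inputVec {n m : ℕ} (A : Matrix (Fin n) (Fin n) ℝ) (B : Matrix (Fin n) (Fin m) ℝ) {t : ℕ}
    (i : Fin m) (k : Fin t) : Fin n → ℝ :=
  fun r => (A ^ (t - (k : ℕ) - 1) * B) r i

/-- The active actuators `σ_k = {i | s_i(k) > 0}` at time `k`. -/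
noncomputable def activeSet {m t : ℕ} (s : Fin m → Fin t → ℝ) (k : Fin t) : Finset (Fin m) :=
  Finset.univ.filter fun i => 0 < s i k

/-- The average number of active actuators, `(∑_k card σ_k) / t`. -/
noncomputable def avgActive {m t : ℕ} (s : Fin m → Fin t → ℝ) : ℝ :=
  (∑ k, ((activeSet s k).card : ℝ)) / t

/-- The controllability Gramian at time `t` of the scheduled system
`x(k+1) = A x(k) + ∑_{i ∈ σ_k} s_i(k) b_i u_i(k)`. -/
noncomputable def schedGramian {n m t : ℕ} (A : Matrix (Fin n) (Fin n) ℝ)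
    (B : Matrix (Fin n) (Fin m) ℝ) (s : Fin m → Fin t → ℝ) : Matrix (Fin n) (Fin n) ℝ :=
  ∑ k, ∑ j ∈ activeSet s k, s j k ^ 2 • Matrix.vecMulVec (inputVec A B j k) (inputVec A B j k)

/-- The weighted schedule `s` (nonnegative scalings) is an `(ε, d)`-approximation of the fully
actuated system: `(1 - ε) W(t) ⪯ W_s(t) ⪯ (1 + ε) W(t)`, with at most `d` active actuators on
average. -/
def IsApproximation {n m t : ℕ} (A : Matrix (Fin n) (Fin n) ℝ) (B : Matrix (Fin n) (Fin m) ℝ)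
    (ε d : ℝ) (s : Fin m → Fin t → ℝ) : Prop :=
  (∀ i k, 0 ≤ s i k) ∧
  (schedGramian A B s - (1 - ε) • gramian A B t).PosSemidef ∧
  ((1 + ε) • gramian A B t - schedGramian A B s).PosSemidef ∧
  avgActive s ≤ d

/-- The sampling probability
`π(i,k) = tr ((C(t) C(t)ᵀ)† A^{t-k-1} b_i (A^{t-k-1} b_i)ᵀ) / n` (leverage score divided by `n`),
with time `k ∈ {0, …, t-1}`. -/
noncomputable def levProb {n m : ℕ} (A : Matrix (Fin n) (Fin n) ℝ) (B : Matrix (Fin n) (Fin m) ℝ)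
    (t : ℕ) (p : Fin m × Fin t) : ℝ :=
  (pinv (ctrbMatrix A B t * (ctrbMatrix A B t)ᵀ) *
    Matrix.vecMulVec (inputVec A B p.1 p.2) (inputVec A B p.1 p.2)).trace / n

theorem gramian_eq_ctrb {n m : ℕ} (A : Matrix (Fin n) (Fin n) ℝ) (B : Matrix (Fin n) (Fin m) ℝ)
    (t : ℕ) : gramian A B t = ctrbMatrix A B t * (ctrbMatrix A B t)ᵀ := by
  ext r c
  have h : ∀ i : Fin t, A ^ (i : ℕ) * B * Bᵀ * (A ^ (i : ℕ))ᵀ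
      = (A ^ (i : ℕ) * B) * (A ^ (i : ℕ) * B)ᵀ := by
    intro i
    rw [Matrix.transpose_mul, Matrix.mul_assoc]
  simp only [gramian, h, Matrix.sum_apply, Matrix.mul_apply (M := ctrbMatrix A B t),
    Fintype.sum_prod_type]
  refine Finset.sum_congr rfl fun i _ => ?_
  rw [Matrix.mul_apply]
  rfl

/-- The rank-one terms `A^{t-k-1} b_i (A^{t-k-1} b_i)ᵀ` sum up to the Gramian. -/
theorem sum_vecMulVec {n m : ℕ} (A : Matrix (Fin n) (Fin n) ℝ) (B : Matrix (Fin n) (Fin m) ℝ)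
    (t : ℕ) : ∑ p : Fin m × Fin t, Matrix.vecMulVec (inputVec A B p.1 p.2) (inputVec A B p.1 p.2)
      = ctrbMatrix A B t * (ctrbMatrix A B t)ᵀ := by
  ext r c
  simp only [Matrix.sum_apply, Matrix.mul_apply (M := ctrbMatrix A B t), Fintype.sum_prod_type]
  rw [Finset.sum_comm, ← Equiv.sum_comp Fin.revPerm]
  refine Finset.sum_congr rfl fun k _ => Finset.sum_congr rfl fun i _ => ?_
  have hk : t - ((Fin.revPerm k : Fin t) : ℕ) - 1 = (k : ℕ) := by
    simp only [Fin.revPerm_apply, Fin.val_rev]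
    have := k.isLt
    omega
  simp only [Matrix.vecMulVec_apply, inputVec, hk]
  rfl

theorem gramian_posDef {n m : ℕ} {A : Matrix (Fin n) (Fin n) ℝ} {B : Matrix (Fin n) (Fin m) ℝ}
    {t : ℕ} (hAB : IsControllable A B) (ht : n ≤ t) :
    (ctrbMatrix A B t * (ctrbMatrix A B t)ᵀ).PosDef := by
  have hli : LinearIndependent ℝ (ctrbMatrix A B n).row := by
    rw [linearIndependent_iff_card_eq_finrank_span, Set.finrank,
      ← Matrix.rank_eq_finrank_span_row, Fintype.card_fin]
    exact hAB.symm
  have hinj : Function.Injective (ctrbMatrix A B n).vecMul :=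
    Matrix.vecMul_injective_iff.mpr hli
  have hinj' : Function.Injective (ctrbMatrix A B t).vecMul := by
    intro v w hvw
    apply hinj
    funext p
    exact congrFun hvw (Fin.castLE ht p.1, p.2)
  have h := Matrix.PosDef.mul_conjTranspose_self (ctrbMatrix A B t) hinj'
  rwa [Matrix.conjTranspose_eq_transpose_of_trivial] at h

theorem levProb_nonneg {n m : ℕ} {A : Matrix (Fin n) (Fin n) ℝ} {B : Matrix (Fin n) (Fin m) ℝ}
    {t : ℕ} (hAB : IsControllable A B) (ht : n ≤ t) (p : Fin m × Fin t) :
    0 ≤ levProb A B t p := by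
  have hW := gramian_posDef hAB ht
  unfold levProb
  rw [pinv_eq_inv ((Matrix.isUnit_iff_isUnit_det _).mp hW.isUnit), Matrix.mul_vecMulVec,
    Matrix.trace_vecMulVec, dotProduct_comm]
  refine div_nonneg ?_ (Nat.cast_nonneg n)
  simpa using hW.inv.posSemidef.dotProduct_mulVec_nonneg (inputVec A B p.1 p.2)

/-- The sampling probabilities add up to one. -/
theorem levProb_sum {n m : ℕ} {A : Matrix (Fin n) (Fin n) ℝ} {B : Matrix (Fin n) (Fin m) ℝ}
    {t : ℕ} (hn : 0 < n) (hAB : IsControllable A B) (ht : n ≤ t) :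
    ∑ p, levProb A B t p = 1 := by
  have hW := gramian_posDef hAB ht
  have hu := (Matrix.isUnit_iff_isUnit_det _).mp hW.isUnit
  have hn' : (n : ℝ) ≠ 0 := by positivity
  unfold levProb
  rw [← Finset.sum_div, ← Matrix.trace_sum, ← Matrix.mul_sum, sum_vecMulVec, pinv_eq_inv hu,
    Matrix.nonsing_inv_mul _ hu]
  simp [hn']

/-- The probability distribution `π` on (actuator, time) pairs from which the algorithm samples. -/
noncomputable def levPMF {n m t : ℕ} (A : Matrix (Fin n) (Fin n) ℝ) (B : Matrix (Fin n) (Fin m) ℝ)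
    (hn : 0 < n) (hAB : IsControllable A B) (ht : n ≤ t) : PMF (Fin m × Fin t) :=
  PMF.ofFintype (fun p => ENNReal.ofReal (levProb A B t p)) (by
    rw [← ENNReal.ofReal_sum_of_nonneg fun p _ => levProb_nonneg hAB ht p,
      levProb_sum hn hAB ht, ENNReal.ofReal_one])

/-- The joint law of `M` independent samples from `π`. -/
noncomputable def sampleLaw {n m t : ℕ} (A : Matrix (Fin n) (Fin n) ℝ)
    (B : Matrix (Fin n) (Fin m) ℝ) (hn : 0 < n) (hAB : IsControllable A B) (ht : n ≤ t) (M : ℕ) :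
    MeasureTheory.Measure (Fin M → Fin m × Fin t) :=
  MeasureTheory.Measure.pi fun _ => (levPMF A B hn hAB ht).toMeasure

/-- The schedule built from the samples `ω`: starting from zero, each time the pair `(i, k)` is
drawn, the squared scaling `s_i(k)²` (the weight of the pair in the Gramian) is increased by
`1 / (M π(i,k))`. -/
noncomputable def randSchedule {n m t M : ℕ} (A : Matrix (Fin n) (Fin n) ℝ)
    (B : Matrix (Fin n) (Fin m) ℝ) (ω : Fin M → Fin m × Fin t) : Fin m → Fin t → ℝ :=
  fun i k => Real.sqrt (∑ j, if ω j = (i, k) then 1 / ((M : ℝ) * levProb A B t (i, k)) else 0)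

end ActuatorScheduling

/-!
After the change of coordinates which turns the Gramian `W(t)` into the identity, the leverage score
`n π(i,k)` of a pair is the squared length of its input vector `y`. Hence the rank-one matrix
`X = π⁻¹ y yᵀ` attached to a random pair satisfies `E X = 1` and `X² = n X` exactly, the Gramian of
the random schedule is the average of `M` independent copies of `X`, and the theorem asks for a
matrix Chernoff bound: all eigenvalues of this average lie between `1 - ε` and `1 + ε`.

The bound is proved by the Laplace transform method of Ahlswede and Winter. Since `X² = n X`, one has
`exp (θ X) = 1 + ((exp (θ n) - 1) / n) X`, whose mean is a scalar; by the Golden–Thompson inequality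
each sample multiplies the expected trace exponential by at most this scalar
(`Matrix.sum_trace_exp_add_le`). Markov's inequality with `θ = ±ε / (2 n)` bounds each of the two
failure probabilities by `n exp (-M ε² / (4 n))` (`Matrix.sum_prod_not_posSemidef_le`), which is at
most `1 / 4` for `M ≥ 12 n log n / ε²` and `n ≥ 2`.

The Golden–Thompson inequality (`Matrix.trace_exp_add_le`) is deduced from the Lie–Trotter product
formula and the inequality `tr (X Y) ^ N ≤ tr (X ^ N Y ^ N)` for symmetric `X`, `Y` and `N` a power
of two (`Matrix.trace_mul_pow_le`). The latter is an induction in which the inequality for smaller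
exponents gives `tr Z ^ (2 N) ≤ tr (Z Zᵀ) ^ N` for all square `Z`, and this one, at `Z = X Y`, gives
the next exponent.
-/

open Matrix Filter Topology

/-! ### Trace inequalities for powers -/

section TracePowers

variable {n : Type*} [Fintype n] [DecidableEq n]

/-- The inequality of arithmetic and geometric means for the Frobenius inner product of `X` and
`Yᵀ`. -/
theorem Matrix.two_mul_trace_mul_le (X Y : Matrix n n ℝ) :
    2 * (X * Y).trace ≤ (X * Xᵀ).trace + (Yᵀ * Y).trace := by
  have h : 0 ≤ ((X - Yᵀ) * (X - Yᵀ)ᵀ).trace := by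
    simp only [Matrix.trace, Matrix.diag, Matrix.mul_apply, Matrix.transpose_apply]
    exact Finset.sum_nonneg fun i _ => Finset.sum_nonneg fun j _ => mul_self_nonneg _
  have e : (X - Yᵀ) * (X - Yᵀ)ᵀ = X * Xᵀ - X * Y - (X * Y)ᵀ + Yᵀ * Y := by
    simp only [Matrix.transpose_sub, Matrix.transpose_transpose, Matrix.transpose_mul]
    noncomm_ring
  rw [e, Matrix.trace_add, Matrix.trace_sub, Matrix.trace_sub, Matrix.trace_transpose] at h
  linarith

theorem Matrix.trace_mul_pow_comm (X Y : Matrix n n ℝ) (N : ℕ) :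
    ((X * Y) ^ N).trace = ((Y * X) ^ N).trace := by
  cases N with
  | zero => simp
  | succ N =>
    have h : ∀ k : ℕ, (X * Y) ^ k * X = X * (Y * X) ^ k := by
      intro k
      induction k with
      | zero => simp
      | succ k ih =>
        rw [pow_succ', Matrix.mul_assoc, ih, pow_succ']
        simp only [Matrix.mul_assoc]
    rw [pow_succ, ← Matrix.mul_assoc, h, Matrix.mul_assoc, Matrix.trace_mul_comm,
      Matrix.mul_assoc, ← pow_succ]

/-- If the Lieb–Thirring inequality holds for all exponents `2 ^ a` with `a < k`, then the
Weyl-type inequality `tr M ^ (2 ^ (k + 1)) ≤ tr (M Mᵀ) ^ (2 ^ k)` holds: starting from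
`tr M ^ (2 N) ≤ tr (M ^ N (M ^ N)ᵀ)`, halve the power inside and double the power outside. -/
theorem Matrix.trace_pow_le_trace_mul_transpose_pow (k : ℕ)
    (H : ∀ a < k, ∀ X Y : Matrix n n ℝ, Xᵀ = X → Yᵀ = Y →
      ((X * Y) ^ 2 ^ a).trace ≤ (X ^ 2 ^ a * Y ^ 2 ^ a).trace)
    (M : Matrix n n ℝ) :
    (M ^ 2 ^ (k + 1)).trace ≤ ((M * Mᵀ) ^ 2 ^ k).trace := by
  have key : ∀ a ≤ k,
      (M ^ 2 ^ (k + 1)).trace ≤ ((M ^ 2 ^ (k - a) * (M ^ 2 ^ (k - a))ᵀ) ^ 2 ^ a).trace := by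
    intro a
    induction a with
    | zero =>
      intro _
      have h := Matrix.two_mul_trace_mul_le (M ^ 2 ^ k) (M ^ 2 ^ k)
      rw [Matrix.trace_mul_comm (M ^ 2 ^ k)ᵀ, ← pow_add, ← two_mul, ← pow_succ'] at h
      simp only [Nat.sub_zero, pow_zero, pow_one]
      linarith
    | succ a ih =>
      intro ha
      refine (ih (by omega)).trans ?_
      obtain ⟨b, rfl⟩ : ∃ b, k = b + a + 1 := ⟨k - a - 1, by omega⟩
      rw [show b + a + 1 - a = b + 1 by omega, show b + a + 1 - (a + 1) = b by omega]
      set R := M ^ 2 ^ b with hR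
      have e1 : M ^ 2 ^ (b + 1) = R * R := by rw [hR, ← pow_add, ← two_mul, ← pow_succ']
      have e2 : R * R * (R * R)ᵀ = R * (R * Rᵀ * Rᵀ) := by
        simp only [Matrix.transpose_mul, Matrix.mul_assoc]
      have e3 : R * Rᵀ * Rᵀ * R = (R * Rᵀ) * (Rᵀ * R) := by
        simp only [Matrix.mul_assoc]
      rw [e1, e2, Matrix.trace_mul_pow_comm, e3]
      have s1 : (R * Rᵀ)ᵀ = R * Rᵀ := by simp
      have s2 : (Rᵀ * R)ᵀ = Rᵀ * R := by simp
      refine (H a (by omega) _ _ s1 s2).trans ?_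
      have h := Matrix.two_mul_trace_mul_le ((R * Rᵀ) ^ 2 ^ a) ((Rᵀ * R) ^ 2 ^ a)
      rw [Matrix.transpose_pow (R * Rᵀ), Matrix.transpose_pow (Rᵀ * R), s1, s2,
        ← pow_add, ← pow_add, ← two_mul, ← pow_succ', Matrix.trace_mul_pow_comm Rᵀ R] at h
      linarith
  simpa using key k le_rfl

/-- The Lieb–Thirring trace inequality for exponents that are powers of two. -/
theorem Matrix.trace_mul_pow_le (k : ℕ) : ∀ X Y : Matrix n n ℝ, Xᵀ = X → Yᵀ = Y →
    ((X * Y) ^ 2 ^ k).trace ≤ (X ^ 2 ^ k * Y ^ 2 ^ k).trace := by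
  induction k using Nat.strong_induction_on with
  | _ k ih =>
    intro X Y hX hY
    cases k with
    | zero => simp
    | succ k =>
      refine (Matrix.trace_pow_le_trace_mul_transpose_pow k
        (fun a ha => ih a (by omega)) (X * Y)).trans ?_
      have e1 : X * Y * (X * Y)ᵀ = X * (Y ^ 2 * X) := by
        rw [Matrix.transpose_mul, hX, hY, pow_two]
        simp only [Matrix.mul_assoc]
      have e2 : Y ^ 2 * X * X = Y ^ 2 * X ^ 2 := by rw [pow_two X, Matrix.mul_assoc]
      rw [e1, Matrix.trace_mul_pow_comm, e2, Matrix.trace_mul_pow_comm]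
      refine (ih k (by omega) (X ^ 2) (Y ^ 2) (by rw [Matrix.transpose_pow, hX])
        (by rw [Matrix.transpose_pow, hY])).trans_eq ?_
      rw [← pow_mul, ← pow_mul, ← pow_succ']

end TracePowers

/-! ### The Lie–Trotter formula and the Golden–Thompson inequality -/

section LieTrotter

theorem norm_pow_sub_pow_le_mul {𝔸 : Type*} [NormedRing 𝔸] [NormOneClass 𝔸] {P Q : 𝔸}
    {r : ℝ} (hP : ‖P‖ ≤ r) (hQ : ‖Q‖ ≤ r) (N : ℕ) :
    ‖P ^ (N + 1) - Q ^ (N + 1)‖ ≤ (N + 1) * r ^ N * ‖P - Q‖ := by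
  induction N with
  | zero => simp
  | succ N ih =>
    have hr : 0 ≤ r := (norm_nonneg P).trans hP
    have e : P ^ (N + 1 + 1) - Q ^ (N + 1 + 1)
        = P ^ (N + 1) * (P - Q) + (P ^ (N + 1) - Q ^ (N + 1)) * Q := by
      rw [pow_succ P (N + 1), pow_succ Q (N + 1)]; noncomm_ring
    rw [e]
    have h1 : ‖P ^ (N + 1)‖ ≤ r ^ (N + 1) :=
      (norm_pow_le _ _).trans (pow_le_pow_left₀ (norm_nonneg _) hP _)
    calc _ ≤ ‖P ^ (N + 1)‖ * ‖P - Q‖ + ‖P ^ (N + 1) - Q ^ (N + 1)‖ * ‖Q‖ :=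
          (norm_add_le _ _).trans (add_le_add (norm_mul_le _ _) (norm_mul_le _ _))
      _ ≤ r ^ (N + 1) * ‖P - Q‖ + ((N + 1) * r ^ N * ‖P - Q‖) * r := by gcongr
      _ = _ := by push_cast; ring

variable {𝔸 : Type*} [NormedRing 𝔸] [NormedAlgebra ℝ 𝔸] [CompleteSpace 𝔸]

theorem hasDerivAt_exp_smul_zero (X : 𝔸) :
    HasDerivAt (fun s : ℝ => NormedSpace.exp (s • X)) X 0 := by
  simpa using hasDerivAt_exp_smul_const (𝕂 := ℝ) X (0 : ℝ)

/-- The Lie–Trotter product formula. -/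
theorem tendsto_exp_mul_exp_pow [NormOneClass 𝔸] (X Y : 𝔸) :
    Tendsto (fun N : ℕ => (NormedSpace.exp ((1 / ((N : ℝ) + 1)) • X) *
        NormedSpace.exp ((1 / ((N : ℝ) + 1)) • Y)) ^ (N + 1)) atTop
      (𝓝 (NormedSpace.exp (X + Y))) := by
  -- `P` and `Q` have the same derivative at `0`, so `P s - Q s = o(s)`, while `Q (1/N) ^ N` is the
  -- limit for every `N`.
  set P : ℝ → 𝔸 := fun s => NormedSpace.exp (s • X) * NormedSpace.exp (s • Y) with hPdef
  set Q : ℝ → 𝔸 := fun s => NormedSpace.exp (s • (X + Y)) with hQdef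
  have hP : HasDerivAt P (X + Y) 0 := by
    have h := (hasDerivAt_exp_smul_zero X).mul (hasDerivAt_exp_smul_zero Y)
    simp only [zero_smul, NormedSpace.exp_zero, mul_one, one_mul] at h
    exact h
  have hQ : HasDerivAt Q (X + Y) 0 := hasDerivAt_exp_smul_zero (X + Y)
  have hP0 : P 0 = 1 := by simp [hPdef]
  have hQ0 : Q 0 = 1 := by simp [hQdef]
  have hs : Tendsto (fun N : ℕ => (1 / ((N : ℝ) + 1))) atTop (𝓝[≠] 0) :=
    tendsto_nhdsWithin_iff.mpr ⟨tendsto_one_div_add_atTop_nhds_zero_nat,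
      Eventually.of_forall fun N => by simp; positivity⟩
  have hD : Tendsto (fun N : ℕ => ((N : ℝ) + 1) *
      ‖P (1 / ((N : ℝ) + 1)) - Q (1 / ((N : ℝ) + 1))‖) atTop (𝓝 0) := by
    have h := ((hP.sub hQ).tendsto_slope_zero.comp hs).norm
    simp only [sub_self, norm_zero] at h
    refine h.congr fun N => ?_
    have hN : (0 : ℝ) < N + 1 := by positivity
    simp [hP0, hQ0, norm_smul, abs_of_pos hN]
  set r : ℝ := ‖X + Y‖ + 1 with hr
  have bound : ∀ F : ℝ → 𝔸, HasDerivAt F (X + Y) 0 → F 0 = 1 →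
      ∀ᶠ N : ℕ in atTop, ‖F (1 / ((N : ℝ) + 1))‖ ≤ 1 + r / (N + 1) := by
    intro F hF hF0
    have h := (hF.tendsto_slope_zero.comp hs).norm
    have h2 := h.eventually (eventually_le_nhds (lt_add_one ‖X + Y‖))
    filter_upwards [h2] with N hN
    have hN1 : (0 : ℝ) < N + 1 := by positivity
    simp only [Function.comp, zero_add, hF0, norm_smul, one_div, inv_inv, Real.norm_eq_abs,
      abs_of_pos hN1] at hN
    have : ‖F (1 / ((N : ℝ) + 1)) - 1‖ ≤ r / (N + 1) := by
      rw [le_div_iff₀ hN1, mul_comm, one_div]; exact hN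
    calc ‖F (1 / ((N : ℝ) + 1))‖ = ‖1 + (F (1 / ((N : ℝ) + 1)) - 1)‖ := by congr 1; abel
      _ ≤ ‖(1 : 𝔸)‖ + ‖F (1 / ((N : ℝ) + 1)) - 1‖ := norm_add_le _ _
      _ ≤ _ := by rw [norm_one]; gcongr
  have hmain : Tendsto (fun N : ℕ => P (1 / ((N : ℝ) + 1)) ^ (N + 1)
      - Q (1 / ((N : ℝ) + 1)) ^ (N + 1)) atTop (𝓝 0) := by
    have hD' : Tendsto (fun N : ℕ => Real.exp r * (((N : ℝ) + 1) *
      ‖P (1 / ((N : ℝ) + 1)) - Q (1 / ((N : ℝ) + 1))‖)) atTop (𝓝 0) := by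
      simpa using hD.const_mul (Real.exp r)
    refine squeeze_zero_norm' ?_ hD'
    filter_upwards [bound P hP hP0, bound Q hQ hQ0] with N h1 h2
    refine (norm_pow_sub_pow_le_mul h1 h2 N).trans ?_
    have hN1 : (0 : ℝ) < N + 1 := by positivity
    have hr0 : 0 < r := by positivity
    have h3 : (1 + r / ((N : ℝ) + 1)) ^ N ≤ Real.exp r := by
      calc (1 + r / ((N : ℝ) + 1)) ^ N ≤ Real.exp (r / (N + 1)) ^ N := by
            gcongr; rw [add_comm]; exact Real.add_one_le_exp _
        _ = Real.exp (N * (r / (N + 1))) := by rw [Real.exp_nat_mul]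
        _ ≤ Real.exp r := by
            gcongr
            rw [← mul_div_assoc, div_le_iff₀ hN1]; nlinarith
    calc ((N : ℝ) + 1) * (1 + r / (N + 1)) ^ N * ‖P (1 / ((N : ℝ) + 1)) - Q (1 / ((N : ℝ) + 1))‖
        ≤ ((N : ℝ) + 1) * Real.exp r * ‖P (1 / ((N : ℝ) + 1)) - Q (1 / ((N : ℝ) + 1))‖ := by
          gcongr
      _ = _ := by ring
  have hQN : ∀ N : ℕ, Q (1 / ((N : ℝ) + 1)) ^ (N + 1) = NormedSpace.exp (X + Y) := by
    intro N
    have hN1 : (N : ℝ) + 1 ≠ 0 := by positivity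
    let _ : NormedAlgebra ℚ 𝔸 := NormedAlgebra.restrictScalars ℚ ℝ 𝔸
    rw [hQdef]
    simp only
    rw [← NormedSpace.exp_nsmul, ← Nat.cast_smul_eq_nsmul ℝ, smul_smul]
    push_cast
    rw [mul_one_div_cancel hN1, one_smul]
  have := hmain.add_const (NormedSpace.exp (X + Y))
  simp only [hQN, sub_add_cancel, zero_add] at this
  exact this

end LieTrotter

/-- The Lie–Trotter product formula for matrices, whose topology is that of entrywise
convergence. -/
theorem Matrix.tendsto_exp_mul_exp_pow {n : Type*} [Fintype n] [DecidableEq n] [Nonempty n]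
    (X Y : Matrix n n ℝ) :
    Tendsto (fun N : ℕ => (NormedSpace.exp ((1 / ((N : ℝ) + 1)) • X) *
        NormedSpace.exp ((1 / ((N : ℝ) + 1)) • Y)) ^ (N + 1)) atTop
      (𝓝 (NormedSpace.exp (X + Y))) := by
  let _ : NormedRing (Matrix n n ℝ) := Matrix.linftyOpNormedRing
  let _ : NormedAlgebra ℝ (Matrix n n ℝ) := Matrix.linftyOpNormedAlgebra
  have _ : NormOneClass (Matrix n n ℝ) := Matrix.linfty_opNormOneClass
  exact _root_.tendsto_exp_mul_exp_pow X Y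

/-- The Golden–Thompson inequality for real symmetric matrices. -/
theorem Matrix.trace_exp_add_le {n : Type*} [Fintype n] [DecidableEq n] [Nonempty n]
    {X Y : Matrix n n ℝ} (hX : Xᵀ = X) (hY : Yᵀ = Y) :
    (NormedSpace.exp (X + Y)).trace ≤ (NormedSpace.exp X * NormedSpace.exp Y).trace := by
  have hcont : Continuous (fun M : Matrix n n ℝ => M.trace) := continuous_id.matrix_trace
  -- The trace inequality is available along powers of two only, which is enough for the limit.
  have h2 : Tendsto (fun k : ℕ => 2 ^ k - 1) atTop atTop :=
    (tendsto_sub_atTop_nat 1).comp (tendsto_pow_atTop_atTop_of_one_lt one_lt_two)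
  have h := (hcont.tendsto _).comp ((Matrix.tendsto_exp_mul_exp_pow X Y).comp h2)
  refine le_of_tendsto h (Eventually.of_forall fun k => ?_)
  have hk : (((2 ^ k - 1 : ℕ) : ℝ) + 1) = ((2 ^ k : ℕ) : ℝ) := by
    exact_mod_cast Nat.sub_add_cancel Nat.one_le_two_pow
  have hpos : ((2 ^ k : ℕ) : ℝ) ≠ 0 := by positivity
  have hroot : ∀ Z : Matrix n n ℝ,
      NormedSpace.exp ((1 / ((2 ^ k : ℕ) : ℝ)) • Z) ^ 2 ^ k = NormedSpace.exp Z := by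
    intro Z
    rw [← Matrix.exp_nsmul, ← Nat.cast_smul_eq_nsmul ℝ, smul_smul, mul_one_div_cancel hpos,
      one_smul]
  simp only [Function.comp, hk, Nat.sub_add_cancel Nat.one_le_two_pow]
  refine (Matrix.trace_mul_pow_le k _ _ ?_ ?_).trans_eq (by rw [hroot, hroot])
  · rw [← Matrix.exp_transpose, Matrix.transpose_smul, hX]
  · rw [← Matrix.exp_transpose, Matrix.transpose_smul, hY]

/-! ### Exponentials of symmetric matrices -/

section MatrixExp

variable {n : Type*} [Fintype n] [DecidableEq n]

/-- The Laplace transform step: a bound on the trace exponential bounds all eigenvalues. -/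
theorem Matrix.IsHermitian.posSemidef_smul_one_sub {H : Matrix n n ℝ} (hH : H.IsHermitian)
    {c : ℝ} (h : (NormedSpace.exp H).trace < Real.exp c) : (c • 1 - H).PosSemidef := by
  set U : Matrix n n ℝ := (hH.eigenvectorUnitary : Matrix n n ℝ) with hU
  have hUU : U * star U = 1 := Unitary.coe_mul_star_self _
  have hUU' : star U * U = 1 := Unitary.coe_star_mul_self _
  have hUi : U⁻¹ = star U := Matrix.inv_eq_right_inv hUU
  have hspec : H = U * diagonal hH.eigenvalues * U⁻¹ := by
    rw [hUi]
    have := hH.spectral_theorem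
    rwa [Unitary.conjStarAlgAut_apply] at this
  have htr : (NormedSpace.exp H).trace = ∑ i, Real.exp (hH.eigenvalues i) := by
    conv_lhs => rw [hspec]
    rw [Matrix.exp_conj _ _ ((Matrix.isUnit_iff_isUnit_det _).mpr
      (Matrix.isUnit_det_of_right_inverse hUU)), Matrix.exp_diagonal, hUi, Matrix.trace_mul_cycle,
      hUU', one_mul, Matrix.trace_diagonal]
    exact Finset.sum_congr rfl fun i _ => by rw [Pi.coe_exp, ← Real.exp_eq_exp_ℝ]
  have hle : ∀ i, hH.eigenvalues i ≤ c := fun i => by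
    have h1 : Real.exp (hH.eigenvalues i) ≤ ∑ i, Real.exp (hH.eigenvalues i) :=
      Finset.single_le_sum (f := fun i => Real.exp (hH.eigenvalues i))
        (fun j _ => (Real.exp_pos _).le) (Finset.mem_univ i)
    exact (Real.exp_lt_exp.mp (h1.trans_lt (htr ▸ h))).le
  have e : c • 1 - H = U * diagonal (fun i => c - hH.eigenvalues i) * Uᴴ := by
    have hd : diagonal (fun i => c - hH.eigenvalues i)
        = c • (1 : Matrix n n ℝ) - diagonal hH.eigenvalues := by
      rw [Matrix.smul_one_eq_diagonal, Matrix.diagonal_sub]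
    rw [hd, mul_sub, sub_mul, ← star_eq_conjTranspose, ← hUi, ← hspec, hUi,
      mul_smul_comm, mul_one, smul_mul_assoc, hUU]
  rw [e]
  exact (Matrix.PosSemidef.diagonal fun i => sub_nonneg.mpr (hle i)).mul_mul_conjTranspose_same U

/-- The exponential of a multiple of a matrix `X` with `X² = L X`, e.g. of a rank-one matrix. -/
theorem Matrix.exp_smul_of_mul_self_eq_smul {X : Matrix n n ℝ} {L : ℝ} (hL : L ≠ 0)
    (hX : X * X = L • X) (θ : ℝ) :
    NormedSpace.exp (θ • X) = 1 + ((Real.exp (θ * L) - 1) / L) • X := by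
  let _ : NormedRing (Matrix n n ℝ) := Matrix.linftyOpNormedRing
  let _ : NormedAlgebra ℝ (Matrix n n ℝ) := Matrix.linftyOpNormedAlgebra
  -- `L⁻¹ • X` is idempotent; `0 ^ k` isolates the constant term of the power series.
  have hpow : ∀ k : ℕ, (θ • X) ^ k = ((θ * L) ^ k / L) • X + (0 : ℝ) ^ k • (1 - L⁻¹ • X) := by
    intro k
    induction k with
    | zero => simp
    | succ k ih =>
      rw [pow_succ, ih, add_mul, smul_mul_smul_comm, hX, smul_smul]
      have : (1 - L⁻¹ • X) * (θ • X) = 0 := by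
        rw [sub_mul, one_mul, smul_mul_smul_comm, hX, smul_smul, sub_eq_zero]
        congr 1
        field_simp
      rw [smul_mul_assoc, this, smul_zero, zero_pow (Nat.succ_ne_zero k), zero_smul]
      congr 2
      ring
  have h1 := NormedSpace.exp_series_hasSum_exp' (𝕂 := ℝ) (θ • X)
  have h2 := NormedSpace.exp_series_hasSum_exp' (𝕂 := ℝ) (θ * L)
  have h3 := NormedSpace.exp_series_hasSum_exp' (𝕂 := ℝ) (0 : ℝ)
  rw [← Real.exp_eq_exp_ℝ] at h2 h3
  have h4 := ((h2.div_const L).smul_const X).add (h3.smul_const (1 - L⁻¹ • X))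
  have hterm : (fun k : ℕ => ((k.factorial : ℝ)⁻¹) • (θ • X) ^ k) = fun k : ℕ =>
      (((k.factorial : ℝ)⁻¹ • (θ * L) ^ k) / L) • X
        + ((k.factorial : ℝ)⁻¹ • (0 : ℝ) ^ k) • (1 - L⁻¹ • X) := by
    funext k
    rw [hpow, smul_add, smul_smul, smul_smul, smul_eq_mul, smul_eq_mul, mul_div_assoc]
  rw [hterm] at h1
  refine (h1.unique h4).trans ?_
  rw [Real.exp_zero, one_smul, sub_div, sub_smul, one_div]
  abel

end MatrixExp

/-! ### The matrix Chernoff bound -/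

section Chernoff

variable {n ι : Type*} [Fintype n] [DecidableEq n] [Fintype ι]

/-- One step of the trace-exponential recursion: by Golden–Thompson, adding an independent sample
`X` with `X² = L X` and mean `1` multiplies the expected trace exponential by at most a scalar. -/
theorem Matrix.sum_trace_exp_add_le [Nonempty n] {π : ι → ℝ} (hπ : ∀ p, 0 ≤ π p)
    (hsum : ∑ p, π p = 1)
    {X : ι → Matrix n n ℝ} {L : ℝ} (hL : 0 < L) (hXs : ∀ p, (X p)ᵀ = X p)
    (hXX : ∀ p, X p * X p = L • X p) (hmean : ∑ p, π p • X p = 1) (θ : ℝ)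
    {S : Matrix n n ℝ} (hS : Sᵀ = S) :
    ∑ p, π p * (NormedSpace.exp (θ • X p + S)).trace
      ≤ (1 + (Real.exp (θ * L) - 1) / L) * (NormedSpace.exp S).trace := by
  calc ∑ p, π p * (NormedSpace.exp (θ • X p + S)).trace
      ≤ ∑ p, π p * (NormedSpace.exp (θ • X p) * NormedSpace.exp S).trace := by
        refine Finset.sum_le_sum fun p _ => mul_le_mul_of_nonneg_left ?_ (hπ p)
        exact Matrix.trace_exp_add_le (by rw [Matrix.transpose_smul, hXs]) hS
    _ = ((∑ p, π p • (1 + ((Real.exp (θ * L) - 1) / L) • X p)) * NormedSpace.exp S).trace := by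
        rw [Finset.sum_mul, Matrix.trace_sum]
        refine Finset.sum_congr rfl fun p _ => ?_
        rw [Matrix.exp_smul_of_mul_self_eq_smul hL.ne' (hXX p), smul_mul_assoc,
          Matrix.trace_smul, smul_eq_mul]
    _ = _ := by
        simp only [smul_add, smul_comm (π _), Finset.sum_add_distrib, ← Finset.smul_sum, hmean,
          ← Finset.sum_smul, hsum]
        rw [one_smul, add_mul, one_mul, smul_mul_assoc, one_mul, Matrix.trace_add,
          Matrix.trace_smul, smul_eq_mul]
        ring

/-- Bound on the expected trace exponential of a sum of `M` independent samples from `π`; the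
expectation is a sum over all sample sequences `ω`, weighted by `∏ j, π (ω j)`. -/
theorem Matrix.sum_prod_mul_trace_exp_le [Nonempty n] {π : ι → ℝ} (hπ : ∀ p, 0 ≤ π p)
    (hsum : ∑ p, π p = 1)
    {X : ι → Matrix n n ℝ} {L : ℝ} (hL : 0 < L) (hXs : ∀ p, (X p)ᵀ = X p)
    (hXX : ∀ p, X p * X p = L • X p) (hmean : ∑ p, π p • X p = 1) (θ : ℝ)
    (hg : 0 ≤ 1 + (Real.exp (θ * L) - 1) / L) (M : ℕ) :
    ∑ ω : Fin M → ι, (∏ j, π (ω j)) * (NormedSpace.exp (θ • ∑ j, X (ω j))).trace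
      ≤ (1 + (Real.exp (θ * L) - 1) / L) ^ M * Fintype.card n := by
  induction M with
  | zero => simp
  | succ M ih =>
    rw [← (Fin.consEquiv fun _ => ι).sum_comp, Fintype.sum_prod_type, Finset.sum_comm]
    simp only [Fin.consEquiv_apply, Fin.prod_univ_succ, Fin.sum_univ_succ, Fin.cons_zero,
      Fin.cons_succ, smul_add]
    calc _ = ∑ ω : Fin M → ι, (∏ j, π (ω j)) *
          ∑ p, π p * (NormedSpace.exp (θ • X p + θ • ∑ j, X (ω j))).trace := by
          refine Finset.sum_congr rfl fun ω _ => ?_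
          rw [Finset.mul_sum]
          exact Finset.sum_congr rfl fun p _ => by ring
      _ ≤ ∑ ω : Fin M → ι, (∏ j, π (ω j)) * ((1 + (Real.exp (θ * L) - 1) / L) *
          (NormedSpace.exp (θ • ∑ j, X (ω j))).trace) := by
          refine Finset.sum_le_sum fun ω _ => mul_le_mul_of_nonneg_left ?_
            (Finset.prod_nonneg fun j _ => hπ _)
          refine Matrix.sum_trace_exp_add_le hπ hsum hL hXs hXX hmean θ ?_
          simp only [Matrix.transpose_smul, Matrix.transpose_sum, hXs]
      _ = (1 + (Real.exp (θ * L) - 1) / L) * ∑ ω : Fin M → ι, (∏ j, π (ω j)) *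
          (NormedSpace.exp (θ • ∑ j, X (ω j))).trace := by
          rw [Finset.mul_sum]
          exact Finset.sum_congr rfl fun ω _ => by ring
      _ ≤ _ := by
          rw [pow_succ', mul_assoc]
          exact mul_le_mul_of_nonneg_left ih hg

/-- One-sided matrix Chernoff bound. Positive `η` controls the largest eigenvalue of the sum of the
samples, negative `η` the smallest one. -/
theorem Matrix.sum_prod_not_posSemidef_le [Nonempty n] {π : ι → ℝ} (hπ : ∀ p, 0 ≤ π p)
    (hsum : ∑ p, π p = 1)
    {X : ι → Matrix n n ℝ} {L : ℝ} (hL : 1 ≤ L) (hXs : ∀ p, (X p)ᵀ = X p)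
    (hXX : ∀ p, X p * X p = L • X p) (hmean : ∑ p, π p • X p = 1) {η : ℝ} (hη : |η| ≤ 1)
    (M : ℕ) (s : Finset (Fin M → ι))
    (hs : ∀ ω ∈ s, ¬ ((η / L * ((1 + 2 * η) * M)) • 1
      - (η / L) • ∑ j, X (ω j)).PosSemidef) :
    ∑ ω ∈ s, ∏ j, π (ω j) ≤ Fintype.card n * Real.exp (-(M * η ^ 2 / L)) := by
  have hL0 : 0 < L := by linarith
  -- Markov's inequality for `tr exp ((η / L) ∑ X)` at the level `exp c`.
  set c := η / L * ((1 + 2 * η) * M) with hc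
  have hg : 0 ≤ 1 + (Real.exp (η / L * L) - 1) / L := by
    have h1 : 1 / L ≤ 1 := by rw [div_le_one hL0]; exact hL
    have h2 : 0 ≤ Real.exp (η / L * L) / L := by positivity
    rw [sub_div]; linarith
  have hexp := Matrix.sum_prod_mul_trace_exp_le hπ hsum hL0 hXs hXX hmean (η / L) hg M
  rw [div_mul_cancel₀ _ hL0.ne'] at hexp hg
  have hgM : (1 + (Real.exp η - 1) / L) ^ M ≤ Real.exp (M * ((η + η ^ 2) / L)) := by
    rw [Real.exp_nat_mul]
    refine pow_le_pow_left₀ hg ?_ M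
    have h3 := (abs_le.mp (Real.abs_exp_sub_one_sub_id_le hη)).2
    calc 1 + (Real.exp η - 1) / L ≤ (η + η ^ 2) / L + 1 := by
          rw [add_comm]; gcongr; linarith
      _ ≤ _ := Real.add_one_le_exp _
  have hprod : ∀ ω : Fin M → ι, 0 ≤ ∏ j, π (ω j) := fun ω => Finset.prod_nonneg fun j _ => hπ _
  have htrace : ∀ ω : Fin M → ι, 0 ≤ (NormedSpace.exp ((η / L) • ∑ j, X (ω j))).trace := by
    intro ω
    have h2 : (NormedSpace.exp ((η / L) • ∑ j, X (ω j)))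
        = NormedSpace.exp ((1 / 2 : ℝ) • (η / L) • ∑ j, X (ω j)) *
          (NormedSpace.exp ((1 / 2 : ℝ) • (η / L) • ∑ j, X (ω j)))ᵀ := by
      rw [← Matrix.exp_transpose]
      simp only [Matrix.transpose_smul, Matrix.transpose_sum, hXs]
      rw [← Matrix.exp_add_of_commute _ _ (Commute.refl _), ← add_smul, add_halves, one_smul]
    rw [h2]
    simp only [Matrix.trace, Matrix.diag, Matrix.mul_apply, Matrix.transpose_apply]
    exact Finset.sum_nonneg fun i _ => Finset.sum_nonneg fun j _ => mul_self_nonneg _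
  have hmarkov : (∑ ω ∈ s, ∏ j, π (ω j)) * Real.exp c
      ≤ ∑ ω : Fin M → ι, (∏ j, π (ω j)) * (NormedSpace.exp ((η / L) • ∑ j, X (ω j))).trace := by
    rw [Finset.sum_mul]
    refine (Finset.sum_le_sum fun ω hω => mul_le_mul_of_nonneg_left ?_ (hprod ω)).trans
      (Finset.sum_le_sum_of_subset_of_nonneg (Finset.subset_univ s)
        fun ω _ _ => mul_nonneg (hprod ω) (htrace ω))
    by_contra! hlt
    refine hs ω hω (Matrix.IsHermitian.posSemidef_smul_one_sub ?_ hlt)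
    rw [Matrix.IsHermitian, Matrix.conjTranspose_eq_transpose_of_trivial]
    simp only [Matrix.transpose_smul, Matrix.transpose_sum, hXs]
  rw [← le_div_iff₀ (Real.exp_pos c)] at hmarkov
  refine hmarkov.trans ?_
  rw [div_le_iff₀ (Real.exp_pos c), mul_assoc, ← Real.exp_add]
  have he : -(M * η ^ 2 / L) + c = M * ((η + η ^ 2) / L) := by rw [hc]; field_simp; ring
  rw [he, mul_comm (Fintype.card n : ℝ)]
  exact hexp.trans (mul_le_mul_of_nonneg_right hgM (Nat.cast_nonneg _))

/-- Two-sided matrix Chernoff bound for sums of `M` independent samples, weighted by `π`, of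
matrices `X` with mean `1` and `X² = L X`. -/
theorem Matrix.sum_prod_not_between_le [Nonempty n] {π : ι → ℝ} (hπ : ∀ p, 0 ≤ π p)
    (hsum : ∑ p, π p = 1)
    {X : ι → Matrix n n ℝ} {L : ℝ} (hL : 1 ≤ L) (hXs : ∀ p, (X p)ᵀ = X p)
    (hXX : ∀ p, X p * X p = L • X p) (hmean : ∑ p, π p • X p = 1) {ε : ℝ} (hε0 : 0 < ε)
    (hε1 : ε ≤ 1) (M : ℕ) (s : Finset (Fin M → ι))
    (hs : ∀ ω ∈ s, ¬ ((∑ j, X (ω j) - ((1 - ε) * M) • 1).PosSemidef ∧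
      (((1 + ε) * M) • 1 - ∑ j, X (ω j)).PosSemidef)) :
    ∑ ω ∈ s, ∏ j, π (ω j) ≤ 2 * (Fintype.card n * Real.exp (-(M * ε ^ 2 / (4 * L)))) := by
  classical
  have hL0 : 0 < L := by linarith
  -- A bad sample violates the upper bound (`η = ε / 2`), or else the lower one (`η = -ε / 2`).
  set P : (Fin M → ι) → Prop := fun ω => (((1 + ε) * M) • 1 - ∑ j, X (ω j)).PosSemidef with hP
  have hc : ∀ η : ℝ, η ^ 2 = ε ^ 2 / 4 →
      Real.exp (-(M * η ^ 2 / L)) = Real.exp (-(M * ε ^ 2 / (4 * L))) := by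
    intro η h; rw [h]; congr 1; field_simp
  have h1 := Matrix.sum_prod_not_posSemidef_le hπ hsum hL hXs hXX hmean (η := -(ε / 2))
    (by rw [abs_neg, abs_of_pos] <;> linarith) M (s.filter P) (by
      intro ω hω hpos
      obtain ⟨hω, hPω⟩ := Finset.mem_filter.mp hω
      refine hs ω hω ⟨?_, hPω⟩
      have := hpos.smul (show 0 ≤ 2 * L / ε by positivity)
      convert this using 1
      rw [smul_sub, smul_smul, smul_smul]
      have e1 : 2 * L / ε * (-(ε / 2) / L) = -1 := by field_simp
      have e2 : 2 * L / ε * (-(ε / 2) / L * ((1 + 2 * -(ε / 2)) * M)) = -((1 - ε) * M) := by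
        field_simp; ring
      rw [e1, e2, neg_smul, neg_smul, one_smul]
      abel)
  have h2 := Matrix.sum_prod_not_posSemidef_le hπ hsum hL hXs hXX hmean (η := ε / 2)
    (by rw [abs_of_pos] <;> linarith) M (s.filter fun ω => ¬ P ω) (by
      intro ω hω hpos
      obtain ⟨hω, hPω⟩ := Finset.mem_filter.mp hω
      refine hPω ?_
      have := hpos.smul (show 0 ≤ 2 * L / ε by positivity)
      rw [hP]
      convert this using 1
      rw [smul_sub, smul_smul, smul_smul]
      have e1 : 2 * L / ε * ((ε / 2) / L) = 1 := by field_simp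
      have e2 : 2 * L / ε * ((ε / 2) / L * ((1 + 2 * (ε / 2)) * M)) = ((1 + ε) * M) := by
        field_simp
      rw [e1, e2, one_smul])
  rw [hc _ (by ring)] at h1 h2
  rw [← Finset.sum_filter_add_sum_filter_not s P]
  linarith

end Chernoff

/-! ### Leverage-score sampling of the controllability Gramian -/

section Sampling

open ActuatorScheduling

variable {n m t : ℕ} {A : Matrix (Fin n) (Fin n) ℝ} {B : Matrix (Fin n) (Fin m) ℝ}

theorem sampleLaw_finset (hn : 0 < n) (hAB : IsControllable A B) (ht : n ≤ t) (M : ℕ)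
    (s : Finset (Fin M → Fin m × Fin t)) :
    sampleLaw A B hn hAB ht M s = ENNReal.ofReal (∑ ω ∈ s, ∏ j, levProb A B t (ω j)) := by
  rw [← MeasureTheory.sum_measure_singleton, ENNReal.ofReal_sum_of_nonneg
    fun ω _ => Finset.prod_nonneg fun j _ => levProb_nonneg hAB ht _]
  refine Finset.sum_congr rfl fun ω _ => ?_
  rw [sampleLaw, MeasureTheory.Measure.pi_singleton, ENNReal.ofReal_prod_of_nonneg
    fun j _ => levProb_nonneg hAB ht _]
  refine Finset.prod_congr rfl fun j _ => ?_
  rw [PMF.toMeasure_apply_singleton _ _ (measurableSet_singleton _)]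
  rfl

/-- An event has probability at least `1 / 2` as soon as every finite set of samples that avoids it
has total weight at most `1 / 2`. -/
theorem half_le_sampleLaw (hn : 0 < n) (hAB : IsControllable A B) (ht : n ≤ t) (M : ℕ)
    (E : Set (Fin M → Fin m × Fin t))
    (h : ∀ s : Finset (Fin M → Fin m × Fin t), (∀ ω ∈ s, ω ∉ E) →
      ∑ ω ∈ s, ∏ j, levProb A B t (ω j) ≤ 1 / 2) :
    (1 / 2 : ENNReal) ≤ sampleLaw A B hn hAB ht M E := by
  classical
  have hprob : MeasureTheory.IsProbabilityMeasure (sampleLaw A B hn hAB ht M) := by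
    unfold sampleLaw; infer_instance
  have hE : MeasurableSet E := E.toFinite.measurableSet
  have hbad : sampleLaw A B hn hAB ht M Eᶜ ≤ 1 / 2 := by
    have e : Eᶜ = ((Finset.univ.filter fun ω => ω ∉ E : Finset _) : Set _) := by ext; simp
    rw [e, sampleLaw_finset]
    refine (ENNReal.ofReal_le_ofReal (h _ (by simp))).trans_eq ?_
    rw [ENNReal.ofReal_div_of_pos two_pos]
    simp
  have hadd := MeasureTheory.prob_add_prob_compl (μ := sampleLaw A B hn hAB ht M) hE
  by_contra! hlt
  have := ENNReal.add_lt_add_of_lt_of_le (by simp) hlt hbad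
  rw [hadd, ENNReal.add_halves] at this
  exact lt_irrefl _ this

/-- Every active pair has been drawn, so there are at most `M` of them. -/
theorem avgActive_randSchedule_le {M : ℕ} (ω : Fin M → Fin m × Fin t) :
    avgActive (randSchedule A B ω) ≤ (M : ℝ) / t := by
  classical
  unfold avgActive
  refine div_le_div_of_nonneg_right ?_ (Nat.cast_nonneg t)
  rw [← Nat.cast_sum, Nat.cast_le]
  calc ∑ k, (activeSet (randSchedule A B ω) k).card
      = (Finset.univ.sigma fun k => activeSet (randSchedule A B ω) k).card := by
        rw [Finset.card_sigma]
    _ ≤ (Finset.univ.image fun j => (⟨(ω j).2, (ω j).1⟩ : (_ : Fin t) × Fin m)).card := by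
        refine Finset.card_le_card fun x hx => ?_
        obtain ⟨k, i⟩ := x
        have hx := (Finset.mem_sigma.mp hx).2
        by_contra hno
        have hne : ∀ j, ω j ≠ (i, k) := fun j hj =>
          hno (Finset.mem_image.mpr ⟨j, Finset.mem_univ j, by rw [hj]⟩)
        simp [activeSet, randSchedule, hne] at hx
    _ ≤ M := Finset.card_image_le.trans (by simp)

/-- The Gramian of the random schedule is the average of the sampled, reweighted rank-one terms. -/
theorem schedGramian_randSchedule (hAB : IsControllable A B) (ht : n ≤ t) {M : ℕ}
    (ω : Fin M → Fin m × Fin t) :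
    schedGramian A B (randSchedule A B ω) = (M : ℝ)⁻¹ • ∑ j, (levProb A B t (ω j))⁻¹ •
      vecMulVec (inputVec A B (ω j).1 (ω j).2) (inputVec A B (ω j).1 (ω j).2) := by
  have hnn : ∀ i k, 0 ≤ ∑ j, if ω j = (i, k) then
      1 / ((M : ℝ) * levProb A B t (i, k)) else 0 := fun i k =>
    Finset.sum_nonneg fun j _ => by
      have := levProb_nonneg hAB ht (i, k)
      split_ifs <;> positivity
  have h1 : schedGramian A B (randSchedule A B ω) = ∑ k, ∑ i, (∑ j, if ω j = (i, k) then
      1 / ((M : ℝ) * levProb A B t (i, k)) else 0) •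
        vecMulVec (inputVec A B i k) (inputVec A B i k) := by
    unfold schedGramian
    refine Finset.sum_congr rfl fun k _ => ?_
    rw [activeSet, Finset.sum_filter]
    refine Finset.sum_congr rfl fun i _ => ?_
    split_ifs with hpos
    · rw [randSchedule, Real.sq_sqrt (hnn i k)]
    · have h0 : randSchedule A B ω i k = 0 := le_antisymm (not_lt.mp hpos) (Real.sqrt_nonneg _)
      rw [randSchedule, Real.sqrt_eq_zero (hnn i k)] at h0
      rw [h0, zero_smul]
  rw [h1, Finset.sum_comm, ← Fintype.sum_prod_type (f := fun p : Fin m × Fin t =>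
    (∑ j, if ω j = (p.1, p.2) then 1 / ((M : ℝ) * levProb A B t (p.1, p.2)) else 0) •
        vecMulVec (inputVec A B p.1 p.2) (inputVec A B p.1 p.2))]
  simp only [Finset.sum_smul]
  rw [Finset.sum_comm, Finset.smul_sum]
  refine Finset.sum_congr rfl fun j _ => ?_
  simp only [ite_smul, zero_smul, Prod.mk.eta]
  rw [Finset.sum_ite_eq Finset.univ (ω j), if_pos (Finset.mem_univ _), smul_smul, one_div,
    mul_inv]

/-- In coordinates where the Gramian is the identity, the reweighted rank-one terms `X p`
have mean `1` under the leverage-score distribution, and all of them satisfy `X² = n X`: the leverage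
score of a pair is the squared length of its input vector in these coordinates. -/
theorem exists_whitening (hn : 0 < n) (hAB : IsControllable A B) (ht : n ≤ t) :
    ∃ (S : Matrix (Fin n) (Fin n) ℝ) (X : Fin m × Fin t → Matrix (Fin n) (Fin n) ℝ),
      gramian A B t = Sᵀ * S ∧
      (∀ p, (levProb A B t p)⁻¹ • vecMulVec (inputVec A B p.1 p.2) (inputVec A B p.1 p.2)
        = Sᵀ * X p * S) ∧
      (∀ p, (X p)ᵀ = X p) ∧ (∀ p, X p * X p = (n : ℝ) • X p) ∧
      ∑ p, levProb A B t p • X p = 1 := by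
  have hW := gramian_posDef hAB ht
  have hWu := (Matrix.isUnit_iff_isUnit_det _).mp hW.isUnit
  have hW' := gramian_eq_ctrb A B t
  obtain ⟨S, hS⟩ : ∃ S : Matrix (Fin n) (Fin n) ℝ,
      ctrbMatrix A B t * (ctrbMatrix A B t)ᵀ = Sᵀ * S := by
    open scoped MatrixOrder Matrix.Norms.L2Operator in
    obtain ⟨S, hS⟩ := CStarAlgebra.nonneg_iff_eq_star_mul_self.mp hW.posSemidef.nonneg
    exact ⟨S, by rw [hS, star_eq_conjTranspose, conjTranspose_eq_transpose_of_trivial]⟩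
  have hSu : IsUnit S.det := by
    rw [hS, det_mul, det_transpose] at hWu
    exact isUnit_of_mul_isUnit_left hWu
  have hSTu : IsUnit Sᵀ.det := by rwa [det_transpose]
  set y : Fin m × Fin t → Fin n → ℝ := fun p => Sᵀ⁻¹ *ᵥ inputVec A B p.1 p.2 with hy
  have hyv : ∀ p, inputVec A B p.1 p.2 = Sᵀ *ᵥ y p := fun p => by
    rw [hy, mulVec_mulVec, mul_nonsing_inv _ hSTu, one_mulVec]
  have hvv : ∀ p, vecMulVec (inputVec A B p.1 p.2) (inputVec A B p.1 p.2)
      = Sᵀ * vecMulVec (y p) (y p) * S := fun p => by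
    rw [hyv p, mul_vecMulVec, vecMulVec_mul, ← mulVec_transpose]
  have hn' : (n : ℝ) ≠ 0 := by positivity
  have hyy : ∀ p, y p ⬝ᵥ y p = n * levProb A B t p := fun p => by
    rw [levProb, pinv_eq_inv hWu, hS, Matrix.mul_inv_rev, mul_div_cancel₀ _ hn', hvv,
      Matrix.mul_assoc,
      ← Matrix.mul_assoc Sᵀ⁻¹, ← Matrix.mul_assoc Sᵀ⁻¹, nonsing_inv_mul _ hSTu, Matrix.one_mul,
      Matrix.trace_mul_comm, Matrix.mul_assoc, mul_nonsing_inv _ hSu, Matrix.mul_one,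
      trace_vecMulVec]
  refine ⟨S, fun p => (levProb A B t p)⁻¹ • vecMulVec (y p) (y p), hW'.trans hS, fun p => ?_,
    fun p => ?_, fun p => ?_, ?_⟩
  · rw [hvv, mul_smul_comm, smul_mul_assoc]
  · rw [transpose_smul, transpose_vecMulVec]
  · rw [smul_mul_smul_comm, vecMulVec_mul_vecMulVec, hyy, vecMulVec_smul, smul_smul, smul_smul]
    congr 1
    -- a pair of probability zero has weight zero
    rcases eq_or_ne (levProb A B t p) 0 with h0 | h0
    · simp [h0]
    · field_simp
  · have hterm : ∀ p, levProb A B t p • (levProb A B t p)⁻¹ • vecMulVec (y p) (y p)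
        = vecMulVec (y p) (y p) := fun p => by
      rcases eq_or_ne (levProb A B t p) 0 with h0 | h0
      · have : y p = 0 := by
          rw [← dotProduct_self_eq_zero, hyy, h0, mul_zero]
        rw [this]; simp
      · rw [smul_smul, mul_inv_cancel₀ h0, one_smul]
    simp only [hterm]
    have hsum := sum_vecMulVec A B t
    simp only [hvv] at hsum
    rw [← Finset.sum_mul, ← Finset.mul_sum, hS] at hsum
    calc ∑ p, vecMulVec (y p) (y p) = Sᵀ⁻¹ * (Sᵀ * (∑ p, vecMulVec (y p) (y p)) * S) * S⁻¹ := by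
          rw [Matrix.mul_assoc Sᵀ, nonsing_inv_mul_cancel_left _ _ hSTu,
            mul_nonsing_inv_cancel_right _ _ hSu]
      _ = 1 := by
          rw [hsum, nonsing_inv_mul_cancel_left _ _ hSTu, mul_nonsing_inv _ hSu]

end Sampling

theorem mainTheorem3 :
    ∃ C : ℝ, 0 < C ∧
      ∀ (n m t : ℕ) (A : Matrix (Fin n) (Fin n) ℝ) (B : Matrix (Fin n) (Fin m) ℝ)
        (hn : 0 < n) (hAB : ActuatorScheduling.IsControllable A B) (ht : n ≤ t)
        (ε : ℝ), 1 / Real.sqrt n ≤ ε → ε < 1 →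
        ∀ d : ℝ, C * (n * Real.log n / (ε ^ 2 * t)) ≤ d →
          (1 / 2 : ENNReal) ≤
            ActuatorScheduling.sampleLaw A B hn hAB ht ⌈d * t⌉₊
              {ω | ActuatorScheduling.IsApproximation A B ε ((⌈d * t⌉₊ : ℝ) / t)
                (ActuatorScheduling.randSchedule A B ω)} := by
  refine ⟨12, by norm_num, fun n m t A B hn hAB ht ε hε hε1 d hd => ?_⟩
  have hn0 : (0 : ℝ) < n := by exact_mod_cast hn
  have ht0 : (0 : ℝ) < t := by exact_mod_cast hn.trans_le ht
  have hε0 : 0 < ε := lt_of_lt_of_le (by positivity) hε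
  -- For `n = 1` no `ε` is admissible, so `log n` is positive and `2 n exp (-3 log n) ≤ 1 / 2`.
  have hn2 : 2 ≤ n := by
    by_contra! h
    obtain rfl : n = 1 := by omega
    norm_num at hε
    linarith
  have hn2' : (2 : ℝ) ≤ n := by exact_mod_cast hn2
  have hlog0 : 0 < Real.log n := Real.log_pos (by linarith)
  set M := ⌈d * t⌉₊ with hM
  have hMge : 12 * (n * Real.log n / ε ^ 2) ≤ M := by
    refine le_trans ?_ (Nat.le_ceil (d * t))
    calc 12 * (n * Real.log n / ε ^ 2) = 12 * (n * Real.log n / (ε ^ 2 * t)) * t := by field_simp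
      _ ≤ d * t := by gcongr
  have hM0 : (0 : ℝ) < M := lt_of_lt_of_le (by positivity) hMge
  obtain ⟨S, X, hWS, hvX, hXs, hXX, hmean⟩ := exists_whitening hn hAB ht
  have : Nonempty (Fin n) := ⟨⟨0, hn⟩⟩
  refine half_le_sampleLaw hn hAB ht M _ fun s hs => ?_
  refine (Matrix.sum_prod_not_between_le (ε := ε)
    (ActuatorScheduling.levProb_nonneg hAB ht) (ActuatorScheduling.levProb_sum hn hAB ht)
    (by linarith : (1 : ℝ) ≤ n) hXs hXX hmean hε0 hε1.le M s fun ω hω hgood => hs ω hω ?_).trans ?_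
  · have hsched : ActuatorScheduling.schedGramian A B (ActuatorScheduling.randSchedule A B ω)
        = (M : ℝ)⁻¹ • (Sᵀ * (∑ j, X (ω j)) * S) := by
      rw [schedGramian_randSchedule hAB ht]
      simp only [hvX, Finset.sum_mul, Finset.mul_sum]
    have hMinv : 0 ≤ (M : ℝ)⁻¹ := by positivity
    refine ⟨fun i k => Real.sqrt_nonneg _, ?_, ?_, avgActive_randSchedule_le ω⟩
    · have h := (hgood.1.conjTranspose_mul_mul_same S).smul hMinv
      rw [conjTranspose_eq_transpose_of_trivial] at h
      convert h using 1
      rw [hsched, hWS, Matrix.mul_sub, Matrix.sub_mul, smul_sub, mul_smul_comm, smul_mul_assoc,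
        Matrix.mul_one, smul_smul]
      congr 2
      field_simp
    · have h := (hgood.2.conjTranspose_mul_mul_same S).smul hMinv
      rw [conjTranspose_eq_transpose_of_trivial] at h
      convert h using 1
      rw [hsched, hWS, Matrix.mul_sub, Matrix.sub_mul, smul_sub, mul_smul_comm, smul_mul_assoc,
        Matrix.mul_one, smul_smul]
      congr 2
      field_simp
  -- The constant `12` makes the exponent of the Chernoff bound at least `3 log n`.
  · have hexpo : 3 * Real.log n ≤ M * ε ^ 2 / (4 * n) := by
      rw [le_div_iff₀ (by positivity)]
      have := mul_le_mul_of_nonneg_right hMge (sq_nonneg ε)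
      have e : 12 * (n * Real.log n / ε ^ 2) * ε ^ 2 = 12 * (n * Real.log n) := by field_simp
      rw [e] at this
      linarith
    have hexp3 : Real.exp (-(M * ε ^ 2 / (4 * n))) ≤ ((n : ℝ) ^ 3)⁻¹ := by
      calc _ ≤ Real.exp (-(3 * Real.log n)) := Real.exp_le_exp.mpr (neg_le_neg hexpo)
        _ = _ := by
          rw [Real.exp_neg, show 3 * Real.log n = ((3 : ℕ) : ℝ) * Real.log n by norm_num,
            Real.exp_nat_mul, Real.exp_log hn0]
    rw [Fintype.card_fin]
    calc 2 * (n * Real.exp (-(M * ε ^ 2 / (4 * n)))) ≤ 2 * (n * ((n : ℝ) ^ 3)⁻¹) := by gcongr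
      _ = 2 / (n : ℝ) ^ 2 := by field_simp
      _ ≤ 2 / 2 ^ 2 := by gcongr
      _ = 1 / 2 := by norm_num
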